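/- **Setting.** Consider $K$ devices and $N$ preambles, $\mathcal K=\{1,\dots,K\}$, $\mathcal N=\{1,\dots,N\}$, $\mathcal X=\{0,1\}^K$. Let $\mathbf p=(p_{\mathbf x})_{\mathbf x\in\mathcal X}$ be a probability distribution on $\mathcal X$ with $p_{\mathbf 0}<1$, and let $\hat p_{\mathbf x}$ be estimates and $\delta_{\mathbf x}\in[0,1)$ error bounds with $\sum_{\mathbf x}(p_{\mathbf x}-\hat p_{\mathbf x})=0$ and $|p_{\mathbf x}-\hat p_{\mathbf x}|\le\delta_{\mathbf x}$. Put $\underline p_{\mathbf x}=\max\{\hat p_{\mathbf x}-\delta_{\mathbf x},0\}$, $\overline p_{\mathbf x}=\min\{\hat p_{\mathbf x}+\delta_{\mathbf x},1\}$. For $\mathbf B=(b_{k,n})\in\mathbb R^{K\times N}$ let $$T(\mathbf B,\mathbf x)=\sum_{n}\sum_{k}x_kb_{k,n}\prod_{\ell\ne k}(1-x_\ell b_{\ell,n}),\qquad g_{k,n}(\mathbf B,\mathbf x)=\prod_{\ell\neq k}(1-x_\ell b_{\ell,n})-\sum_{\ell\ne k}x_\ell b_{\ell,n}\prod_{j\ne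 \ell,k}(1-x_jb_{j,n}).$$ **Problem 4.** Maximize over $(\mathbf B,\boldsymbol\lambda,\epsilon,\nu)\in\mathbb R^{K\times N}\times\mathbb R^{\mathcal X}\times\mathbb R\times\mathbb R$ $$\Big(\sum_{\mathbf x}\underline p_{\mathbf x}-1\Big)\nu+\sum_{\mathbf x}\big((\underline p_{\mathbf x}-\overline p_{\mathbf x})\lambda_{\mathbf x}+\underline p_{\mathbf x}T(\mathbf B,\mathbf x)\big)$$ subject to $\boldsymbol\lambda\succeq 0$ and $$\text{(i) } 0\le\epsilon\le1,\quad \text{(ii) } b_{k,n}\ge0\ \ \forall k,n,\quad \text{(iii) } \sum_nb_{k,n}=\epsilon\ \ \forall k,\quad \text{(iv) } \nu+\lambda_{\mathbf x}+T(\mathbf B,\mathbf x)\ge0\ \ \forall\mathbf x .$$ **Approximate problem at $\mathbf B'$.** Maximize $$\tilde h=\Big(\sum_{\mathbf x}\underline p_{\mathbf x}-1\Big)\nu+\sum_{\mathbf x}\big((\underline p_{\mathbf x}-\overline p_{\mathbf x})\lambda_{\mathbf x}+\underline p_{\mathbf x}T(\mathbf B',\mathbf x)\big)+\sum_{k,n}\sum_{\mathbf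 x}\underline p_{\mathbf x}x_kg_{k,n}(\mathbf B',\mathbf x)(b_{k,n}-b'_{k,n})-\tfrac12\sqrt{N\sum_k\sum_{\ell\ne k}\Big(\sum_{\mathbf x}\underline p_{\mathbf x}x_kx_\ell\|\mathbf x\|_1\Big)^2}\,\sum_{k,n}(b_{k,n}-b'_{k,n})^2$$ subject to $\boldsymbol\lambda\succeq0$, (i), (ii), (iii), and $\tilde h_{\rm c}(\mathbf B,\boldsymbol\lambda,\nu,\mathbf B',\mathbf x)\ge0$ for all $\mathbf x\in\mathcal X$, where $$\tilde h_{\rm c}(\mathbf B,\boldsymbol\lambda,\nu,\mathbf B',\mathbf x)=\nu+\lambda_{\mathbf x}+T(\mathbf B',\mathbf x)+\sum_{k,n}x_kg_{k,n}(\mathbf B',\mathbf x)(b_{k,n}-b'_{k,n})-\tfrac12\sqrt N\,\|\mathbf x\|_1^2\sum_kx_k\sum_n(b_{k,n}-b'_{k,n})^2 .$$ **Algorithm 3.** Fix $\gamma\in(0,1]$ and any $n_k\in\mathcal N$ $(k\in\mathcal K)$. Start from $\mathbf b^{(0)}_k=\mathbf e_{n_k}$, $\boldsymbol\lambda^{(0)}=\mathbf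 1$, $\epsilon^{(0)}=1$, $\nu^{(0)}=0$. For $s\ge1$ let $\hat{\mathbf z}^{(s)}$ be any optimal point of the approximate problem at $\mathbf B^{(s-1)}$ and set $\mathbf z^{(s)}=(1-\gamma)\mathbf z^{(s-1)}+\gamma\hat{\mathbf z}^{(s)}$, where $\mathbf z=(\mathbf B,\boldsymbol\lambda,\epsilon,\nu)$. (The stopping test is omitted, so that the sequence of iterates is infinite.) **Theorem 6 (Convergence of Algorithm 3).** Let $\mathbf z^\dagger=(\mathbf B^\dagger,\boldsymbol\lambda^\dagger,\epsilon^\dagger,\nu^\dagger)$ be a limit point of the iterates generated by Algorithm 3. If the set $$\{(\mathbf B,\boldsymbol\lambda,\epsilon,\nu):\ \tilde h_{\rm c}(\mathbf B,\boldsymbol\lambda,\nu,\mathbf B^\dagger,\mathbf x)\ge0\ \ \forall\mathbf x\in\mathcal X,\ \text{(i), (ii), (iii)}\}$$ has nonempty interior relative to the affine subspace $\{(\mathbf B,\boldsymbol\lambda,\epsilon,\nu):\sum_nb_{k,n}=\epsilon\ \forall k\in\mathcal K\}$ defined by the equality constraints, then $\mathbf z^\dagger$ is a KKT point of Problem 4: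 it is feasible, and there are multipliers, nonnegative for the inequality constraints and real for the equality constraints, that satisfy complementary slackness and make the gradient of the Lagrangian of Problem 4 vanish at $\mathbf z^\dagger$. -/

import Mathlib

open Filter Topology

noncomputable section

/-! ### Smooth constrained maximization problems and KKT points -/

/-- The problem `max objective z` subject to `ineq i z ≥ 0` for all `i` and `eqn j z = 0`
for all `j`. -/
structure MaxProblem (E ι κ : Type*) where
  objective : E → ℝ
  ineq : ι → E → ℝ
  eqn : κ → E → ℝ

/-- The feasible set. -/
def MaxProblem.feasible {E ι κ : Type*} (P : MaxProblem E ι κ) : Set E :=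
  {z | (∀ i, 0 ≤ P.ineq i z) ∧ ∀ j, P.eqn j z = 0}

/-- `z` is a (globally) optimal point. -/
def MaxProblem.IsOptimal {E ι κ : Type*} (P : MaxProblem E ι κ) (z : E) : Prop :=
  z ∈ P.feasible ∧ IsMaxOn P.objective P.feasible z

/-- `z` is a Karush-Kuhn-Tucker point: the data are differentiable at `z`, `z` is feasible, and
there are multipliers `μ i ≥ 0` (inequalities) and `η j` (equalities) with complementary slackness
and stationarity of the Lagrangian. -/
def MaxProblem.IsKKTPoint {E ι κ : Type*} [NormedAddCommGroup E] [NormedSpace ℝ E]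
    [Fintype ι] [Fintype κ] (P : MaxProblem E ι κ) (z : E) : Prop :=
  DifferentiableAt ℝ P.objective z ∧
  (∀ i, DifferentiableAt ℝ (P.ineq i) z) ∧
  (∀ j, DifferentiableAt ℝ (P.eqn j) z) ∧
  z ∈ P.feasible ∧
  ∃ (μ : ι → ℝ) (η : κ → ℝ),
    (∀ i, 0 ≤ μ i) ∧
    (∀ i, μ i * P.ineq i z = 0) ∧
    fderiv ℝ P.objective z + ∑ i, μ i • fderiv ℝ (P.ineq i) z
      + ∑ j, η j • fderiv ℝ (P.eqn j) z = 0

/-! ### Random access model -/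

/-- Joint activity states of `K` devices: `x k = true` iff device `k` is active. -/
abbrev ActivityState (K : ℕ) : Type := Fin K → Bool

/-- The activity `x_k ∈ {0, 1}` as a real number. -/
def act {K : ℕ} (x : ActivityState K) (k : Fin K) : ℝ := if x k then 1 else 0

/-- `‖x‖₁`, the number of active devices. -/
def l1norm {K : ℕ} (x : ActivityState K) : ℝ := ∑ k, |act x k|

/-- `T(A, ε, x)`: the average number of devices that successfully access the base station
at activity state `x`. -/
def throughput {K N : ℕ} (A : Fin K → Fin N → ℝ) (ε : ℝ) (x : ActivityState K) : ℝ :=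
  ∑ n, ∑ k, act x k * A k n * ε * ∏ l ∈ Finset.univ.erase k, (1 - act x l * A l n * ε)

/-- `g_{k,n}(A, ε, x)`, for which `∂T(A, ε, x)/∂a_{k,n} = x_k ε g_{k,n}(A, ε, x)`. -/
def gCoef {K N : ℕ} (k : Fin K) (n : Fin N) (A : Fin K → Fin N → ℝ) (ε : ℝ)
    (x : ActivityState K) : ℝ :=
  ∏ l ∈ Finset.univ.erase k, (1 - act x l * A l n * ε)
    - ε * ∑ l ∈ Finset.univ.erase k, act x l * A l n *
        ∏ j ∈ (Finset.univ.erase k).erase l, (1 - act x j * A j n * ε)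

/-- Lower bound `max {p̂_x - δ_x, 0}` on the probability of state `x`. -/
def pLower {K : ℕ} (pHat δ : ActivityState K → ℝ) (x : ActivityState K) : ℝ :=
  max (pHat x - δ x) 0

/-- Upper bound `min {p̂_x + δ_x, 1}` on the probability of state `x`. -/
def pUpper {K : ℕ} (pHat δ : ActivityState K → ℝ) (x : ActivityState K) : ℝ :=
  min (pHat x + δ x) 1

/-! ### The worst-case problem in the variables `(B, λ, ε, ν)` -/

/-- The space of the variables `(B, λ, ε, ν)`. -/
abbrev Vars (K N : ℕ) : Type :=
  (Fin K → Fin N → ℝ) × (ActivityState K → ℝ) × ℝ × ℝ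

/-- The component `B`. -/
def Vars.B {K N : ℕ} (z : Vars K N) : Fin K → Fin N → ℝ := z.1

/-- The component `λ`. -/
def Vars.lam {K N : ℕ} (z : Vars K N) : ActivityState K → ℝ := z.2.1

/-- The component `ε`. -/
def Vars.eps {K N : ℕ} (z : Vars K N) : ℝ := z.2.2.1

/-- The component `ν`. -/
def Vars.nu {K N : ℕ} (z : Vars K N) : ℝ := z.2.2.2

/-- Indices of the inequality constraints, in this order: `ε ≥ 0`; `ε ≤ 1`; `b_{k,n} ≥ 0`;
`λ_x ≥ 0`; the (exact or approximate) throughput constraint at `x`. -/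
abbrev IneqIndex (K N : ℕ) : Type :=
  Unit ⊕ Unit ⊕ (Fin K × Fin N) ⊕ ActivityState K ⊕ ActivityState K

/-- The inequality constraint functions, with throughput constraint functions `c`. -/
def ineqFun {K N : ℕ} (c : ActivityState K → Vars K N → ℝ) : IneqIndex K N → Vars K N → ℝ
  | .inl _, z => z.eps
  | .inr (.inl _), z => 1 - z.eps
  | .inr (.inr (.inl (k, n))), z => z.B k n
  | .inr (.inr (.inr (.inl x))), z => z.lam x
  | .inr (.inr (.inr (.inr x))), z => c x z

/-- The equality constraint functions `∑ n, b_{k,n} - ε`. -/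
def eqFun {K N : ℕ} (k : Fin K) (z : Vars K N) : ℝ := ∑ n, z.B k n - z.eps

/-- The objective function of the worst-case problem. -/
def worstObjective {K N : ℕ} (pHat δ : ActivityState K → ℝ) (z : Vars K N) : ℝ :=
  (∑ x, pLower pHat δ x - 1) * z.nu
    + ∑ x, ((pLower pHat δ x - pUpper pHat δ x) * z.lam x
        + pLower pHat δ x * throughput z.B 1 x)

/-- The throughput constraint function `ν + λ_x + T(B, 1, x)`. -/
def worstConstraint {K N : ℕ} (x : ActivityState K) (z : Vars K N) : ℝ :=
  z.nu + z.lam x + throughput z.B 1 x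

/-- The equivalent form of worst-case average throughput maximization. -/
def worstProblem {K N : ℕ} (pHat δ : ActivityState K → ℝ) :
    MaxProblem (Vars K N) (IneqIndex K N) (Fin K) where
  objective := worstObjective pHat δ
  ineq := ineqFun worstConstraint
  eqn := eqFun

/-! ### Successive convex approximation -/

/-- `√(N ∑_k ∑_{l ≠ k} (∑_x p̲_x x_k x_l ‖x‖₁)²)`. -/
def curvature {K : ℕ} (N : ℕ) (pHat δ : ActivityState K → ℝ) : ℝ :=
  Real.sqrt ((N : ℝ) * ∑ k : Fin K, ∑ l ∈ Finset.univ.erase k,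
    (∑ x, pLower pHat δ x * act x k * act x l * l1norm x) ^ 2)

/-- The approximate objective `h̃(B, λ, ν, B')`. -/
def approxObjective {K N : ℕ} (pHat δ : ActivityState K → ℝ) (B' : Fin K → Fin N → ℝ)
    (z : Vars K N) : ℝ :=
  (∑ x, pLower pHat δ x - 1) * z.nu
    + ∑ x, ((pLower pHat δ x - pUpper pHat δ x) * z.lam x
        + pLower pHat δ x * throughput B' 1 x)
    + ∑ k, ∑ n, ∑ x, pLower pHat δ x * act x k * gCoef k n B' 1 x * (z.B k n - B' k n)
    - 1 / 2 * curvature N pHat δ * ∑ k, ∑ n, (z.B k n - B' k n) ^ 2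

/-- The approximate throughput constraint function `h̃_c(B, λ, ν, B', x)`. -/
def approxConstraint {K N : ℕ} (B' : Fin K → Fin N → ℝ) (x : ActivityState K)
    (z : Vars K N) : ℝ :=
  z.nu + z.lam x + throughput B' 1 x
    + ∑ k, ∑ n, act x k * gCoef k n B' 1 x * (z.B k n - B' k n)
    - 1 / 2 * Real.sqrt N * l1norm x ^ 2 * ∑ k, act x k * ∑ n, (z.B k n - B' k n) ^ 2

/-- The convex approximate problem at `B'`. -/
def approxProblem {K N : ℕ} (pHat δ : ActivityState K → ℝ) (B' : Fin K → Fin N → ℝ) :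
    MaxProblem (Vars K N) (IneqIndex K N) (Fin K) where
  objective := approxObjective pHat δ B'
  ineq := ineqFun (approxConstraint B')
  eqn := eqFun

/-- The initial point `((e_{n_k})_k, 1, 1, 0)`. -/
def initialPoint {K N : ℕ} (n : Fin K → Fin N) : Vars K N :=
  (fun k => Pi.single (n k) 1, fun _ => 1, 1, 0)

/-- `z 0, z 1, …` are iterates of the successive convex approximation algorithm with
step `γ`, started at the point given by the preamble choice `n`; at each iteration any optimal
point of the approximate problem may be used. -/
def IsSCARun {K N : ℕ} (pHat δ : ActivityState K → ℝ) (γ : ℝ) (n : Fin K → Fin N)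
    (z : ℕ → Vars K N) : Prop :=
  z 0 = initialPoint n ∧
  ∀ s, ∃ zHat : Vars K N,
    (approxProblem pHat δ (z s).B).IsOptimal zHat ∧
    z (s + 1) = (1 - γ) • z s + γ • zHat

/-- The affine subspace of all `(B, λ, ε, ν)` with `∑ n, b_{k,n} = ε` for all `k`. -/
def equalitySubspace (K N : ℕ) : Set (Vars K N) :=
  {z | ∀ k, ∑ n, z.B k n = z.eps}

/-- The set of all `(B, λ, ε, ν)` with `h̃_c(B, λ, ν, B', x) ≥ 0` for all `x`, `0 ≤ ε ≤ 1`,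
`b_{k,n} ≥ 0` and `∑ n, b_{k,n} = ε`. -/
def approxConstraintSet {K N : ℕ} (B' : Fin K → Fin N → ℝ) : Set (Vars K N) :=
  {z | (∀ x, 0 ≤ approxConstraint B' x z) ∧ 0 ≤ z.eps ∧ z.eps ≤ 1 ∧
    (∀ k n, 0 ≤ z.B k n) ∧ ∀ k, ∑ n, z.B k n = z.eps}

end

/-! For a fixed preamble, the throughput is the probability that exactly one of several independent
events occurs. This probability is affine in each variable, so its Hessian has zero diagonal; the
off-diagonal entries are `q - 2p`, where `p` and `q` are the probabilities of no and of exactly one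
event among the rest, hence at most 2 in modulus on the unit box. Taylor's formula
(`probOne_lower_bound`) and Cauchy-Schwarz then make the approximate objective and constraints
minorants of the exact ones (`approxObjective_le_worstObjective`,
`approxConstraint_le_worstConstraint`), agreeing with them to first order at the base point and
concave.

Consequently each step keeps feasibility and raises the exact objective by at least `γ` times the
gain predicted by the approximate problem (`sca_step`). The objective values along the iterates
therefore increase and stay below the value at any limit point. If a strictly feasible point `w` of
the approximate problem at the limit point had a larger approximate objective, `w` would remain
feasible for iterates close to the limit point, and a single step from there would exceed the limit
value. This is `approxObjective_le_of_limit`; it needs no convergence or boundedness of the optimal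
points `zHat`.

By first-order agreement, the limit point has no ascent direction that strictly increases all active
constraints and preserves the equalities. A strictly feasible point of the concave approximate
problem provides the constraint qualification, and separation of a subspace from the open positive
orthant gives the multipliers (`exists_multipliers_of_no_ascent`). -/

/-! ### Success probabilities of independent transmissions -/

/-- The probability that none of the independent events of probabilities `y l`, `l ∈ s`,
occurs. -/
def probNone {ι : Type*} (s : Finset ι) (y : ι → ℝ) : ℝ := ∏ l ∈ s, (1 - y l)

/-- The probability that exactly one of the independent events of probabilities `y l`, `l ∈ s`,
occurs. -/
def probOne {ι : Type*} [DecidableEq ι] (s : Finset ι) (y : ι → ℝ) : ℝ :=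
  ∑ l ∈ s, y l * probNone (s.erase l) y

section probabilities

variable {ι : Type*} [DecidableEq ι]

lemma probNone_insert {a : ι} {s : Finset ι} (ha : a ∉ s) (y : ι → ℝ) :
    probNone (insert a s) y = (1 - y a) * probNone s y :=
  Finset.prod_insert ha

lemma probOne_insert {a : ι} {s : Finset ι} (ha : a ∉ s) (y : ι → ℝ) :
    probOne (insert a s) y = y a * probNone s y + (1 - y a) * probOne s y := by
  unfold probOne
  rw [Finset.sum_insert ha, Finset.erase_insert ha, Finset.mul_sum]
  congr 1
  refine Finset.sum_congr rfl fun l hl => ?_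
  have hla : a ≠ l := fun h => ha (h ▸ hl)
  rw [Finset.erase_insert_of_ne hla, probNone_insert (fun h => ha (Finset.mem_of_mem_erase h))]
  ring

/-- The two events are disjoint. In the induction the new sum is `probNone s y + (1 - y a) * probOne
s y`. -/
lemma probNone_probOne_bounds (s : Finset ι) {y : ι → ℝ} (hy : ∀ i, 0 ≤ y i ∧ y i ≤ 1) :
    0 ≤ probNone s y ∧ 0 ≤ probOne s y ∧ probNone s y + probOne s y ≤ 1 := by
  induction s using Finset.induction_on with
  | empty => simp [probNone, probOne]
  | insert a s ha ih =>
    obtain ⟨h0, h1, h2⟩ := ih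
    obtain ⟨ha0, ha1⟩ := hy a
    have ha1' : 0 ≤ 1 - y a := by linarith
    rw [probNone_insert ha, probOne_insert ha]
    refine ⟨by positivity, by positivity, ?_⟩
    nlinarith [mul_nonneg ha0 h1]

variable [Fintype ι]

lemma hasFDerivAt_probNone (s : Finset ι) (y : ι → ℝ) :
    HasFDerivAt (probNone s)
      (∑ k ∈ s, (-probNone (s.erase k) y) •
        (ContinuousLinearMap.proj k : (ι → ℝ) →L[ℝ] ℝ)) y := by
  have h := HasFDerivAt.finsetProd (u := s) (x := y) (g := fun l (w : ι → ℝ) => 1 - w l)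
    (g' := fun l => -(ContinuousLinearMap.proj l : (ι → ℝ) →L[ℝ] ℝ))
    (fun l _ => by simpa using (hasFDerivAt_apply (𝕜 := ℝ) l y).const_sub 1)
  refine h.congr_fderiv (ContinuousLinearMap.ext fun d => ?_)
  simp [probNone]

/-- By `probOne_insert`, the function is affine in `y k`, with slope `probNone - probOne` of the
remaining events. -/
lemma hasFDerivAt_probOne (s : Finset ι) (y : ι → ℝ) :
    HasFDerivAt (probOne s)
      (∑ k ∈ s, (probNone (s.erase k) y - probOne (s.erase k) y) •
        (ContinuousLinearMap.proj k : (ι → ℝ) →L[ℝ] ℝ)) y := by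
  have h := HasFDerivAt.fun_sum (u := s) (x := y)
    (A := fun l (w : ι → ℝ) => w l * probNone (s.erase l) w)
    (fun l _ => (hasFDerivAt_apply (𝕜 := ℝ) l y).mul (hasFDerivAt_probNone (s.erase l) y))
  refine h.congr_fderiv (ContinuousLinearMap.ext fun d => ?_)
  simp only [sum_apply, add_apply,
    smul_apply, ContinuousLinearMap.proj_apply, smul_eq_mul,
    Finset.sum_add_distrib, sub_mul, Finset.sum_sub_distrib, probOne, Finset.mul_sum,
    Finset.sum_mul]
  -- The product rule yields a sum over ordered pairs of distinct indices; exchanging the order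
  -- collects the coefficient of each differential.
  rw [Finset.sum_comm' (s' := fun l => s.erase l) (t' := s)
    (h := by intro a b; simp only [Finset.mem_erase]; tauto), add_comm, sub_eq_add_neg,
    ← Finset.sum_neg_distrib]
  congr 1
  refine Finset.sum_congr rfl fun k _ => ?_
  rw [← Finset.sum_neg_distrib]
  refine Finset.sum_congr rfl fun l _ => ?_
  rw [Finset.erase_right_comm]
  ring

/-- Integrating the bound on `f''` twice, in the form of two monotonicity statements. -/
lemma taylor_lower_bound {f f' f'' : ℝ → ℝ} {C : ℝ} (hf : ∀ t, HasDerivAt f (f' t) t)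
    (hf' : ∀ t, HasDerivAt f' (f'' t) t) (hC : ∀ t ∈ Set.Icc (0 : ℝ) 1, -(2 * C) ≤ f'' t) :
    f 0 + f' 0 - C ≤ f 1 := by
  have h1 : MonotoneOn (fun t => f' t + 2 * C * t) (Set.Icc 0 1) := by
    refine monotoneOn_of_hasDerivWithinAt_nonneg (f' := fun t => f'' t + 2 * C) (convex_Icc 0 1)
      ?_ ?_ ?_
    · exact fun t _ => ((hf' t).continuousAt.add (by fun_prop)).continuousWithinAt
    · intro t _
      exact ((hf' t).add (by simpa using (hasDerivAt_id t).const_mul (2 * C))).hasDerivWithinAt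
    · intro t ht
      have := hC t (interior_subset ht)
      linarith
  have h2 : MonotoneOn (fun t => f t - f' 0 * t + C * t ^ 2) (Set.Icc 0 1) := by
    refine monotoneOn_of_hasDerivWithinAt_nonneg (f' := fun t => f' t - f' 0 + C * (2 * t))
      (convex_Icc 0 1) ?_ ?_ ?_
    · exact fun t _ =>
        (((hf t).continuousAt.sub (by fun_prop)).add (by fun_prop)).continuousWithinAt
    · intro t _
      exact (((hf t).sub (by simpa using (hasDerivAt_id t).const_mul (f' 0))).add
        (by simpa using (hasDerivAt_pow 2 t).const_mul C)).hasDerivWithinAt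
    · intro t ht
      have ht := interior_subset ht
      have := h1 (Set.left_mem_Icc.2 zero_le_one) ht ht.1
      simp only at this
      linarith
  have := h2 (Set.left_mem_Icc.2 zero_le_one) (Set.right_mem_Icc.2 zero_le_one) zero_le_one
  simp only at this
  linarith

lemma probOne_lower_bound (s : Finset ι) {y w : ι → ℝ} (hy : ∀ i, 0 ≤ y i ∧ y i ≤ 1)
    (hw : ∀ i, 0 ≤ w i ∧ w i ≤ 1) :
    probOne s y + ∑ k ∈ s, (probNone (s.erase k) y - probOne (s.erase k) y) * (w k - y k)
      - ∑ k ∈ s, ∑ l ∈ s.erase k, |w k - y k| * |w l - y l| ≤ probOne s w := by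
  set d : ι → ℝ := w - y with hd
  have hline : ∀ t : ℝ, HasDerivAt (fun t : ℝ => y + t • d) d t := fun t => by
    simpa using ((hasDerivAt_id t).smul_const d).const_add y
  have hNone : ∀ (s : Finset ι) (t : ℝ), HasDerivAt (fun t : ℝ => probNone s (y + t • d))
      (∑ k ∈ s, -probNone (s.erase k) (y + t • d) * d k) t := fun s t => by
    simpa [Function.comp_def] using
      (hasFDerivAt_probNone s (y + t • d)).comp_hasDerivAt t (hline t)
  have hOne : ∀ (s : Finset ι) (t : ℝ), HasDerivAt (fun t : ℝ => probOne s (y + t • d))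
      (∑ k ∈ s, (probNone (s.erase k) (y + t • d) - probOne (s.erase k) (y + t • d)) * d k) t :=
    fun s t => by
      simpa [Function.comp_def] using
        (hasFDerivAt_probOne s (y + t • d)).comp_hasDerivAt t (hline t)
  have key := taylor_lower_bound (C := ∑ k ∈ s, ∑ l ∈ s.erase k, |d k| * |d l|) (hOne s)
    (fun t => HasDerivAt.fun_sum fun k _ =>
      ((hNone (s.erase k) t).sub (hOne (s.erase k) t)).mul_const (d k)) ?_
  · simpa [hd] using key
  · intro t ht
    have hbox : ∀ i, 0 ≤ (y + t • d) i ∧ (y + t • d) i ≤ 1 := fun i => by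
      have h1 : (y + t • d) i = (1 - t) * y i + t * w i := by simp [hd]; ring
      have ht' : 0 ≤ 1 - t := by linarith [ht.2]
      rw [h1]
      constructor
      · have := mul_nonneg ht' (hy i).1
        have := mul_nonneg ht.1 (hw i).1
        linarith
      · nlinarith [mul_nonneg ht' (sub_nonneg.2 (hy i).2), mul_nonneg ht.1 (sub_nonneg.2 (hw i).2)]
    rw [Finset.mul_sum, ← Finset.sum_neg_distrib]
    refine Finset.sum_le_sum fun k _ => ?_
    rw [← Finset.sum_sub_distrib, Finset.sum_mul, Finset.mul_sum, ← Finset.sum_neg_distrib]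
    refine Finset.sum_le_sum fun l _ => ?_
    obtain ⟨h0, h1, h2⟩ := probNone_probOne_bounds ((s.erase k).erase l) hbox
    -- The mixed second derivative is `q - 2 * p`; since `p` and `q` are nonnegative with sum at
    -- most 1, it lies in `[-2, 1]`.
    set p := probNone ((s.erase k).erase l) (y + t • d)
    set q := probOne ((s.erase k).erase l) (y + t • d)
    have hpq : |q - 2 * p| ≤ 2 := abs_le.2 ⟨by linarith, by linarith⟩
    calc -(2 * (|d k| * |d l|)) ≤ -(|q - 2 * p| * (|d k| * |d l|)) := by gcongr
      _ = -|(q - 2 * p) * (d k * d l)| := by rw [abs_mul, abs_mul]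
      _ ≤ (q - 2 * p) * (d k * d l) := neg_abs_le _
      _ = (-p * d l - (p - q) * d l) * d k := by ring

end probabilities

/-! ### Multipliers from the absence of ascent directions -/

/-- The image of the common kernel of the `h j` under `f` and the active `g i` is a subspace that
misses the open positive orthant; a separating functional has the multipliers as coordinates. -/
lemma exists_multipliers_of_no_ascent {E ι κ : Type*} [NormedAddCommGroup E] [NormedSpace ℝ E]
    [Fintype ι] [Fintype κ] (f : E →L[ℝ] ℝ) (g : ι → E →L[ℝ] ℝ) (h : κ → E →L[ℝ] ℝ)
    (active : ι → Prop)
    (hno : ∀ d, (∀ j, h j d = 0) → (∀ i, active i → 0 < g i d) → f d ≤ 0)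
    (hmf : ∃ d, (∀ j, h j d = 0) ∧ ∀ i, active i → 0 < g i d) :
    ∃ (μ : ι → ℝ) (η : κ → ℝ), (∀ i, 0 ≤ μ i) ∧ (∀ i, ¬ active i → μ i = 0) ∧
      f + ∑ i, μ i • g i + ∑ j, η j • h j = 0 := by
  classical
  let V : Submodule ℝ E := ⨅ j, LinearMap.ker (h j : E →ₗ[ℝ] ℝ)
  have hV : ∀ d, d ∈ V ↔ ∀ j, h j d = 0 := fun d => by simp [V]
  -- The coordinate `none` carries the objective, the coordinates `some i` the active constraints.
  let G : Option {i // active i} → E →ₗ[ℝ] ℝ := fun o => o.elim f (fun i => g i.1)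
  let W : Submodule ℝ (Option {i // active i} → ℝ) := V.map (LinearMap.pi G)
  let S : Set (Option {i // active i} → ℝ) := Set.univ.pi fun _ => Set.Ioi 0
  have hSo : IsOpen S := isOpen_set_pi Set.finite_univ fun _ _ => isOpen_Ioi
  have hSc : Convex ℝ S := convex_pi fun _ _ => convex_Ioi 0
  have hdisj : Disjoint S (W : Set (Option {i // active i} → ℝ)) := by
    rw [Set.disjoint_left]
    rintro _ hS ⟨d, hd, rfl⟩
    have h1 := hno d ((hV d).1 hd) fun i hi => hS (some ⟨i, hi⟩) trivial
    exact absurd (hS none trivial) (not_lt.2 h1)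
  obtain ⟨φ, u, hφS, hφW⟩ := geometric_hahn_banach_open hSc hSo W.convex hdisj
  have hu : u ≤ 0 := by simpa using hφW 0 W.zero_mem
  -- A functional bounded below on a subspace vanishes there: otherwise some multiple of `b` takes
  -- the value `u - 1`.
  have hW0 : ∀ b ∈ W, φ b = 0 := by
    intro b hb
    by_contra hne
    have := hφW (((u - 1) / φ b) • b) (W.smul_mem _ hb)
    rw [map_smul, smul_eq_mul, div_mul_cancel₀ _ hne] at this
    linarith
  have hφsum : ∀ a, φ a = ∑ o, a o * φ (Pi.single o 1) := fun a => by
    conv_lhs => rw [pi_eq_sum_univ' a]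
    simp [map_sum]
  have hneg : ∀ o, φ (Pi.single o 1) ≤ 0 := by
    intro o
    have hcl : Pi.single o (1 : ℝ) ∈ closure S := by
      rw [closure_pi_set]
      intro o' _
      rw [closure_Ioi]
      by_cases ho : o' = o
      · subst ho; simp
      · simp [ho]
    exact closure_minimal (fun a ha => ((hφS a ha).le.trans hu : φ a ≤ 0))
      (isClosed_le φ.continuous continuous_const) hcl
  obtain ⟨d₀, hd₀, hd₀pos⟩ := hmf
  have hrel : ∀ d ∈ V, f d * φ (Pi.single none 1)
      + ∑ i : {i // active i}, g i.1 d * φ (Pi.single (some i) 1) = 0 := by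
    intro d hd
    have := hW0 _ ⟨d, hd, rfl⟩
    rw [hφsum, Fintype.sum_option] at this
    simpa [G] using this
  -- This excludes the degenerate Fritz John case: without weight on the objective, `d₀` forces all
  -- the other weights to vanish, so `φ = 0`, although `φ` is negative on the orthant.
  have hnone : φ (Pi.single none 1) < 0 := by
    refine lt_of_le_of_ne (hneg _) fun h0 => ?_
    have h1 := hrel d₀ ((hV d₀).2 hd₀)
    rw [h0, mul_zero, zero_add, Finset.sum_eq_zero_iff_of_nonpos fun i _ =>
      mul_nonpos_of_nonneg_of_nonpos (hd₀pos i.1 i.2).le (hneg _)] at h1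
    have h2 : φ (fun _ => 1) = 0 := by
      rw [hφsum, Fintype.sum_option, h0]
      simp only [mul_zero, zero_add]
      refine Finset.sum_eq_zero fun i hi => ?_
      rcases mul_eq_zero.1 (h1 i hi) with h | h
      · exact absurd h (hd₀pos i.1 i.2).ne'
      · rw [h, mul_zero]
    have h3 := hφS (fun _ => 1) (fun _ _ => by simp)
    linarith
  set c := φ (Pi.single none 1)
  let μ : ι → ℝ := fun i => if hi : active i then φ (Pi.single (some ⟨i, hi⟩) 1) / c else 0
  have hμsum : ∀ d, ∑ i, μ i * g i d
      = (∑ i : {i // active i}, g i.1 d * φ (Pi.single (some i) 1)) / c := by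
    intro d
    rw [← Fintype.sum_subtype_add_sum_subtype active,
      Finset.sum_eq_zero (s := (Finset.univ : Finset {i // ¬ active i}))
        fun i _ => by simp [μ, i.2], add_zero, Finset.sum_div]
    refine Finset.sum_congr rfl fun i _ => ?_
    simp only [μ, dif_pos i.2]
    ring
  -- A functional that vanishes on the common kernel of finitely many functionals lies in their
  -- span.
  have hspan : ((f + ∑ i, μ i • g i : E →L[ℝ] ℝ) : E →ₗ[ℝ] ℝ) ∈
      Submodule.span ℝ (Set.range fun j => (h j : E →ₗ[ℝ] ℝ)) := by
    refine mem_span_of_iInf_ker_le_ker fun d hd => ?_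
    have h1 := hrel d hd
    have h2 := hμsum d
    have h3 : f d + ∑ i, μ i * g i d = 0 := by
      rw [h2, eq_neg_of_add_eq_zero_right h1, neg_div, mul_div_cancel_right₀ _ hnone.ne,
        add_neg_cancel]
    simpa using h3
  obtain ⟨η, hη⟩ := (Submodule.mem_span_range_iff_exists_fun ℝ).1 hspan
  refine ⟨μ, fun j => -η j, fun i => ?_, fun i hi => by simp [μ, hi], ?_⟩
  · by_cases hi : active i
    · simp only [μ, hi, dif_pos]
      exact div_nonneg_of_nonpos (hneg _) hnone.le
    · simp [μ, hi]
  · ext d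
    have := LinearMap.congr_fun hη d
    simp at this ⊢
    linarith

/-! ### The throughput and its concave minorants -/

section throughput

variable {K N : ℕ}

lemma act_nonneg (x : ActivityState K) (k : Fin K) : 0 ≤ act x k := by
  unfold act; split_ifs <;> norm_num

lemma act_le_one (x : ActivityState K) (k : Fin K) : act x k ≤ 1 := by
  unfold act; split_ifs <;> norm_num

lemma act_mul_self (x : ActivityState K) (k : Fin K) : act x k * act x k = act x k := by
  unfold act; split_ifs <;> norm_num

lemma l1norm_eq (x : ActivityState K) : l1norm x = ∑ k, act x k :=
  Finset.sum_congr rfl fun k _ => abs_of_nonneg (act_nonneg x k)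

lemma pLower_nonneg (pHat δ : ActivityState K → ℝ) (x : ActivityState K) :
    0 ≤ pLower pHat δ x :=
  le_max_right _ _

lemma throughput_eq_probOne (B : Fin K → Fin N → ℝ) (x : ActivityState K) :
    throughput B 1 x = ∑ n, probOne Finset.univ fun k => act x k * B k n := by
  simp [throughput, probOne, probNone]

lemma gCoef_eq_probNone_sub_probOne (k : Fin K) (n : Fin N) (B : Fin K → Fin N → ℝ)
    (x : ActivityState K) :
    gCoef k n B 1 x = probNone (Finset.univ.erase k) (fun k => act x k * B k n)
      - probOne (Finset.univ.erase k) fun k => act x k * B k n := by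
  simp [gCoef, probOne, probNone]

lemma act_mul_mem_unit (x : ActivityState K) {B : Fin K → Fin N → ℝ}
    (hB : ∀ k n, 0 ≤ B k n ∧ B k n ≤ 1) (n : Fin N) (k : Fin K) :
    0 ≤ act x k * B k n ∧ act x k * B k n ≤ 1 :=
  ⟨mul_nonneg (act_nonneg x k) (hB k n).1,
    mul_le_one₀ (act_le_one x k) (hB k n).1 (hB k n).2⟩

lemma throughput_nonneg {B : Fin K → Fin N → ℝ} (hB : ∀ k n, 0 ≤ B k n ∧ B k n ≤ 1)
    (x : ActivityState K) : 0 ≤ throughput B 1 x := by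
  rw [throughput_eq_probOne]
  exact Finset.sum_nonneg fun n _ =>
    (probNone_probOne_bounds _ (act_mul_mem_unit x hB n)).2.1

lemma throughput_lower_bound {B B' : Fin K → Fin N → ℝ} (hB : ∀ k n, 0 ≤ B k n ∧ B k n ≤ 1)
    (hB' : ∀ k n, 0 ≤ B' k n ∧ B' k n ≤ 1) (x : ActivityState K) :
    throughput B' 1 x + ∑ k, ∑ n, act x k * gCoef k n B' 1 x * (B k n - B' k n)
      - ∑ n, ∑ k, ∑ l ∈ Finset.univ.erase k,
        act x k * act x l * (|B k n - B' k n| * |B l n - B' l n|) ≤ throughput B 1 x := by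
  rw [throughput_eq_probOne, throughput_eq_probOne, Finset.sum_comm, ← Finset.sum_add_distrib,
    ← Finset.sum_sub_distrib]
  refine Finset.sum_le_sum fun n _ => ?_
  refine le_trans (le_of_eq ?_) (probOne_lower_bound Finset.univ (act_mul_mem_unit x hB' n)
    (act_mul_mem_unit x hB n))
  congr 1
  · congr 1
    refine Finset.sum_congr rfl fun k _ => ?_
    rw [gCoef_eq_probNone_sub_probOne]
    ring
  · refine Finset.sum_congr rfl fun k _ => Finset.sum_congr rfl fun l _ => ?_
    rw [← mul_sub, ← mul_sub, abs_mul, abs_mul, abs_of_nonneg (act_nonneg x k),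
      abs_of_nonneg (act_nonneg x l)]
    ring

/-- For each preamble, with `m = l1norm x`, Cauchy-Schwarz on the active devices bounds the full
double sum by `m * Q`; removing the diagonal `Q` leaves `(m - 1) * Q`, and `m - 1 ≤ m ^ 2 / 2`. -/
lemma sum_act_pairs_le (x : ActivityState K) (d : Fin K → Fin N → ℝ) :
    ∑ n, ∑ k, ∑ l ∈ Finset.univ.erase k, act x k * act x l * (|d k n| * |d l n|)
      ≤ 1 / 2 * Real.sqrt N * l1norm x ^ 2 * ∑ k, act x k * ∑ n, d k n ^ 2 := by
  simp_rw [Finset.mul_sum (Finset.univ : Finset (Fin N))]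
  rw [Finset.sum_comm (s := (Finset.univ : Finset (Fin K))), Finset.mul_sum]
  refine Finset.sum_le_sum fun n _ => ?_
  have hN : (1 : ℝ) ≤ Real.sqrt N := by
    rw [Real.one_le_sqrt]
    exact_mod_cast Fin.pos n
  set m := l1norm x
  set Q := ∑ k, act x k * d k n ^ 2
  have hQ : 0 ≤ Q := Finset.sum_nonneg fun k _ => mul_nonneg (act_nonneg x k) (sq_nonneg _)
  have hsq : (∑ k, act x k * |d k n|) ^ 2 ≤ m * Q := by
    have h := Finset.sum_mul_sq_le_sq_mul_sq Finset.univ (act x) fun k => act x k * |d k n|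
    have e1 : ∀ k, act x k ^ 2 = act x k := fun k => by rw [sq, act_mul_self]
    simp only [mul_pow, e1, sq_abs, ← mul_assoc, act_mul_self] at h
    rwa [← l1norm_eq] at h
  have hsplit : ∑ k, ∑ l ∈ Finset.univ.erase k, act x k * act x l * (|d k n| * |d l n|)
      = (∑ k, act x k * |d k n|) ^ 2 - Q := by
    rw [sq, Finset.sum_mul_sum, ← Finset.sum_sub_distrib]
    refine Finset.sum_congr rfl fun k _ => ?_
    rw [← Finset.add_sum_erase _ _ (Finset.mem_univ k)]
    have : act x k * |d k n| * (act x k * |d k n|) = act x k * d k n ^ 2 := by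
      rw [← sq_abs (d k n)]
      linear_combination |d k n| ^ 2 * act_mul_self x k
    rw [this, add_sub_cancel_left]
    exact Finset.sum_congr rfl fun l _ => by ring
  rw [hsplit]
  have h1 : m - 1 ≤ 1 / 2 * Real.sqrt N * m ^ 2 := by
    nlinarith [sq_nonneg (m - 1), mul_nonneg (sub_nonneg.2 hN) (sq_nonneg m)]
  nlinarith [mul_le_mul_of_nonneg_right h1 hQ]

lemma approxConstraint_le_worstConstraint {B' : Fin K → Fin N → ℝ} {z : Vars K N}
    (hB' : ∀ k n, 0 ≤ B' k n ∧ B' k n ≤ 1) (hB : ∀ k n, 0 ≤ z.B k n ∧ z.B k n ≤ 1)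
    (x : ActivityState K) : approxConstraint B' x z ≤ worstConstraint x z := by
  have h1 := throughput_lower_bound hB hB' x
  have h2 := sum_act_pairs_le x fun k n => z.B k n - B' k n
  unfold approxConstraint worstConstraint
  linarith

/-- Two distinct active devices force `l1norm x ≥ 2`. This factor 2 offsets the `1 / 2` in front of
the curvature. -/
lemma two_mul_act_mul_act_le (x : ActivityState K) {k l : Fin K} (hkl : l ≠ k) :
    2 * (act x k * act x l) ≤ act x k * act x l * l1norm x := by
  have h : act x k + act x l ≤ l1norm x := by
    rw [l1norm_eq, ← Finset.sum_pair hkl.symm]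
    exact Finset.sum_le_sum_of_subset_of_nonneg (Finset.subset_univ _)
      fun i _ _ => act_nonneg x i
  have h0 := mul_nonneg (act_nonneg x k) (act_nonneg x l)
  have h1 := mul_le_mul_of_nonneg_left h h0
  have h2 : act x k * act x l * (act x k + act x l) = 2 * (act x k * act x l) := by
    linear_combination act x l * act_mul_self x k + act x k * act_mul_self x l
  linarith

/-- Cauchy-Schwarz over the triples `(n, k, l)` with `l ≠ k`. The weights do not depend on `n`,
which produces the factor `N` under the root. -/
lemma sum_pairs_le_curvature (pHat δ : ActivityState K → ℝ) (d : Fin K → Fin N → ℝ) :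
    ∑ n, ∑ k, ∑ l ∈ Finset.univ.erase k,
      (∑ x, pLower pHat δ x * act x k * act x l * l1norm x) * (|d k n| * |d l n|)
      ≤ curvature N pHat δ * ∑ k, ∑ n, d k n ^ 2 := by
  set W : Fin K → Fin K → ℝ := fun k l => ∑ x, pLower pHat δ x * act x k * act x l * l1norm x
  have hsum : ∀ F : Fin N → Fin K → Fin K → ℝ,
      ∑ n, ∑ k, ∑ l ∈ Finset.univ.erase k, F n k l
        = ∑ i ∈ (Finset.univ : Finset (Fin N)) ×ˢ
          (Finset.univ : Finset (Fin K)).sigma (fun k => Finset.univ.erase k),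
            F i.1 i.2.1 i.2.2 := fun F => by
    rw [Finset.sum_product]
    exact Finset.sum_congr rfl fun n _ => by rw [Finset.sum_sigma]
  rw [hsum fun n k l => W k l * (|d k n| * |d l n|)]
  refine (Real.sum_mul_le_sqrt_mul_sqrt _ _ _).trans ?_
  rw [← hsum fun n k l => W k l ^ 2, ← hsum fun n k l => (|d k n| * |d l n|) ^ 2]
  have hQ : 0 ≤ ∑ k, ∑ n, d k n ^ 2 := by positivity
  have hcurv : √(∑ n : Fin N, ∑ k, ∑ l ∈ Finset.univ.erase k, W k l ^ 2)
      = curvature N pHat δ := by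
    rw [Finset.sum_const, Finset.card_univ, Fintype.card_fin, nsmul_eq_mul]
    rfl
  rw [hcurv]
  refine mul_le_mul_of_nonneg_left ?_ (Real.sqrt_nonneg _)
  · refine Real.sqrt_le_iff.2 ⟨hQ, ?_⟩
    rw [Finset.sum_comm (s := (Finset.univ : Finset (Fin K)))
      (t := (Finset.univ : Finset (Fin N))) (f := fun k n => d k n ^ 2)]
    calc ∑ n, ∑ k, ∑ l ∈ Finset.univ.erase k, (|d k n| * |d l n|) ^ 2
        ≤ ∑ n, ∑ k, ∑ l, d k n ^ 2 * d l n ^ 2 := by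
          refine Finset.sum_le_sum fun n _ => Finset.sum_le_sum fun k _ => ?_
          simp only [mul_pow, sq_abs]
          exact Finset.sum_le_sum_of_subset_of_nonneg (Finset.subset_univ _)
            fun i _ _ => by positivity
      _ = ∑ n, (∑ k, d k n ^ 2) ^ 2 :=
          Finset.sum_congr rfl fun n _ => by rw [sq (∑ k, d k n ^ 2), Finset.sum_mul_sum]
      _ ≤ (∑ n, ∑ k, d k n ^ 2) ^ 2 :=
          Finset.sum_sq_le_sq_sum_of_nonneg fun n _ => by positivity

lemma worstObjective_eq (pHat δ : ActivityState K → ℝ) (z : Vars K N) :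
    worstObjective pHat δ z = (∑ x, pLower pHat δ x - 1) * z.nu
      + ∑ x, (pLower pHat δ x - pUpper pHat δ x) * z.lam x
      + ∑ x, pLower pHat δ x * throughput z.B 1 x := by
  rw [worstObjective, Finset.sum_add_distrib, add_assoc]

lemma approxObjective_eq (pHat δ : ActivityState K → ℝ) (B' : Fin K → Fin N → ℝ)
    (z : Vars K N) :
    approxObjective pHat δ B' z = (∑ x, pLower pHat δ x - 1) * z.nu
      + ∑ x, (pLower pHat δ x - pUpper pHat δ x) * z.lam x
      + ∑ x, pLower pHat δ x * throughput B' 1 x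
      + ∑ x, pLower pHat δ x * ∑ k, ∑ n, act x k * gCoef k n B' 1 x * (z.B k n - B' k n)
      - 1 / 2 * curvature N pHat δ * ∑ k, ∑ n, (z.B k n - B' k n) ^ 2 := by
  have h : ∑ x, pLower pHat δ x * ∑ k, ∑ n, act x k * gCoef k n B' 1 x * (z.B k n - B' k n)
      = ∑ k, ∑ n, ∑ x, pLower pHat δ x * act x k * gCoef k n B' 1 x * (z.B k n - B' k n) := by
    simp only [Finset.mul_sum]
    rw [Finset.sum_comm]
    refine Finset.sum_congr rfl fun k _ => ?_
    rw [Finset.sum_comm]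
    exact Finset.sum_congr rfl fun n _ => Finset.sum_congr rfl fun x _ => by ring
  rw [approxObjective, Finset.sum_add_distrib, h, ← add_assoc]

lemma approxObjective_le_worstObjective (pHat δ : ActivityState K → ℝ) {B' : Fin K → Fin N → ℝ}
    {z : Vars K N} (hB' : ∀ k n, 0 ≤ B' k n ∧ B' k n ≤ 1)
    (hB : ∀ k n, 0 ≤ z.B k n ∧ z.B k n ≤ 1) :
    approxObjective pHat δ B' z ≤ worstObjective pHat δ z := by
  set d : Fin K → Fin N → ℝ := fun k n => z.B k n - B' k n
  have h1 : ∑ x, pLower pHat δ x * (throughput B' 1 x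
      + ∑ k, ∑ n, act x k * gCoef k n B' 1 x * d k n
      - ∑ n, ∑ k, ∑ l ∈ Finset.univ.erase k, act x k * act x l * (|d k n| * |d l n|))
      ≤ ∑ x, pLower pHat δ x * throughput z.B 1 x :=
    Finset.sum_le_sum fun x _ => mul_le_mul_of_nonneg_left (throughput_lower_bound hB hB' x)
      (pLower_nonneg pHat δ x)
  have h2 : 2 * ∑ x, pLower pHat δ x *
      ∑ n, ∑ k, ∑ l ∈ Finset.univ.erase k, act x k * act x l * (|d k n| * |d l n|)
      ≤ ∑ n, ∑ k, ∑ l ∈ Finset.univ.erase k,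
      (∑ x, pLower pHat δ x * act x k * act x l * l1norm x) * (|d k n| * |d l n|) := by
    simp only [Finset.mul_sum, Finset.sum_mul]
    rw [Finset.sum_comm]
    refine Finset.sum_le_sum fun n _ => ?_
    rw [Finset.sum_comm]
    refine Finset.sum_le_sum fun k _ => ?_
    rw [Finset.sum_comm]
    refine Finset.sum_le_sum fun l hl => Finset.sum_le_sum fun x _ => ?_
    have h := mul_le_mul_of_nonneg_left (two_mul_act_mul_act_le x (Finset.ne_of_mem_erase hl))
      (mul_nonneg (pLower_nonneg pHat δ x) (mul_nonneg (abs_nonneg (d k n)) (abs_nonneg (d l n))))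
    linarith
  have h3 := sum_pairs_le_curvature pHat δ d
  rw [approxObjective_eq, worstObjective_eq]
  simp only [mul_sub, mul_add, Finset.sum_add_distrib, Finset.sum_sub_distrib] at h1
  simp only [d, mul_sub] at h1 h2 h3 ⊢
  linarith

/-! ### First-order data of the exact problem and expansions of the approximations -/

lemma hasFDerivAt_throughput (x : ActivityState K) (z : Vars K N) :
    ∃ L : Vars K N →L[ℝ] ℝ, HasFDerivAt (fun z : Vars K N => throughput z.B 1 x) L z ∧
      ∀ d : Vars K N, L d = ∑ k, ∑ n, act x k * gCoef k n z.B 1 x * d.B k n := by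
  let A : Fin N → Vars K N →L[ℝ] (Fin K → ℝ) := fun n => ContinuousLinearMap.pi fun k =>
    act x k • ((ContinuousLinearMap.proj n : (Fin N → ℝ) →L[ℝ] ℝ) ∘L
      (ContinuousLinearMap.proj k : (Fin K → Fin N → ℝ) →L[ℝ] (Fin N → ℝ)) ∘L
      ContinuousLinearMap.fst ℝ _ _)
  have h := HasFDerivAt.fun_sum (u := Finset.univ) (x := z) fun n _ =>
    (hasFDerivAt_probOne Finset.univ (A n z)).comp z (A n).hasFDerivAt
  refine ⟨_, h.congr_of_eventuallyEq (Eventually.of_forall fun w => throughput_eq_probOne _ _),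
    fun d => ?_⟩
  rw [Finset.sum_comm, sum_apply]
  refine Finset.sum_congr rfl fun n _ => ?_
  simp only [ContinuousLinearMap.comp_apply, sum_apply, smul_apply,
    ContinuousLinearMap.proj_apply, smul_eq_mul]
  refine Finset.sum_congr rfl fun k _ => ?_
  rw [gCoef_eq_probNone_sub_probOne, mul_comm (act x k), mul_assoc]
  rfl

/-- Along a ray from its base point the approximation is exactly quadratic, with the value and slope
of the exact function. -/
lemma worstConstraint_expansion (x : ActivityState K) (z : Vars K N) :
    ∃ L : Vars K N →L[ℝ] ℝ, HasFDerivAt (worstConstraint x) L z ∧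
      (∀ d : Vars K N, L d
        = d.nu + d.lam x + ∑ k, ∑ n, act x k * gCoef k n z.B 1 x * d.B k n) ∧
      ∀ (d : Vars K N) (t : ℝ), approxConstraint z.B x (z + t • d) = worstConstraint x z + t * L d
        - t ^ 2 * (1 / 2 * Real.sqrt N * l1norm x ^ 2 * ∑ k, act x k * ∑ n, d.B k n ^ 2) := by
  obtain ⟨L, hL, hLd⟩ := hasFDerivAt_throughput x z
  let nuL : Vars K N →L[ℝ] ℝ := ContinuousLinearMap.snd ℝ _ _ ∘L
    ContinuousLinearMap.snd ℝ _ _ ∘L ContinuousLinearMap.snd ℝ _ _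
  let lamL : Vars K N →L[ℝ] ℝ := ContinuousLinearMap.proj x ∘L
    ContinuousLinearMap.fst ℝ _ _ ∘L ContinuousLinearMap.snd ℝ _ _
  have hval : ∀ d : Vars K N, (nuL + lamL + L) d
      = d.nu + d.lam x + ∑ k, ∑ n, act x k * gCoef k n z.B 1 x * d.B k n := fun d => by
    rw [← hLd]; rfl
  refine ⟨nuL + lamL + L, (nuL.hasFDerivAt.add lamL.hasFDerivAt).add hL, hval, fun d t => ?_⟩
  have hB : ∀ k n, (z + t • d).B k n - z.B k n = t * d.B k n := fun k n => by
    simp [Vars.B]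
  have hnu : (z + t • d).nu = z.nu + t * d.nu := rfl
  have hlam : (z + t • d).lam x = z.lam x + t * d.lam x := rfl
  rw [hval]
  unfold approxConstraint worstConstraint
  simp only [hB, hnu, hlam, mul_pow, ← Finset.mul_sum, mul_left_comm _ t, mul_left_comm _ (t ^ 2)]
  ring

lemma worstObjective_expansion (pHat δ : ActivityState K → ℝ) (z : Vars K N) :
    ∃ L : Vars K N →L[ℝ] ℝ, HasFDerivAt (worstObjective pHat δ) L z ∧
      ∀ (d : Vars K N) (t : ℝ), approxObjective pHat δ z.B (z + t • d)
        = worstObjective pHat δ z + t * L d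
          - t ^ 2 * (1 / 2 * curvature N pHat δ * ∑ k, ∑ n, d.B k n ^ 2) := by
  choose L hL hLd using fun x => hasFDerivAt_throughput (N := N) x z
  let nuL : Vars K N →L[ℝ] ℝ := ContinuousLinearMap.snd ℝ _ _ ∘L
    ContinuousLinearMap.snd ℝ _ _ ∘L ContinuousLinearMap.snd ℝ _ _
  let lamL : ActivityState K → Vars K N →L[ℝ] ℝ := fun x => ContinuousLinearMap.proj x ∘L
    ContinuousLinearMap.fst ℝ _ _ ∘L ContinuousLinearMap.snd ℝ _ _
  refine ⟨_, (nuL.hasFDerivAt.const_mul (∑ x, pLower pHat δ x - 1)).add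
    (HasFDerivAt.fun_sum fun x _ => ((lamL x).hasFDerivAt.const_mul
      (pLower pHat δ x - pUpper pHat δ x)).add ((hL x).const_mul (pLower pHat δ x))),
    fun d t => ?_⟩
  have hB : ∀ k n, (z + t • d).B k n - z.B k n = t * d.B k n := fun k n => by
    simp [Vars.B]
  have hnu : (z + t • d).nu = z.nu + t * d.nu := rfl
  have hlam : ∀ x, (z + t • d).lam x = z.lam x + t * d.lam x := fun _ => rfl
  have hnuL : ∀ d, nuL d = d.nu := fun _ => rfl
  have hlamL : ∀ x d, lamL x d = d.lam x := fun _ _ => rfl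
  simp only [add_apply, sum_apply, smul_apply, smul_eq_mul, hnuL, hlamL, hLd]
  rw [approxObjective_eq, worstObjective_eq]
  simp only [hB, hnu, hlam, mul_pow, ← Finset.mul_sum, mul_left_comm _ t,
    mul_left_comm _ (t ^ 2), mul_add, Finset.sum_add_distrib]
  ring

end throughput

/-! ### Convergence of the successive convex approximation -/

section convergence

variable {K N : ℕ}

/-- A common form for all inequality constraints: `0 ≤ q` records concavity, and `q = 0` for the
linear ones. -/
lemma ineqFun_expansion (z : Vars K N) (i : IneqIndex K N) :
    ∃ L : Vars K N →L[ℝ] ℝ, HasFDerivAt (ineqFun worstConstraint i) L z ∧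
      ∀ d : Vars K N, ∃ q : ℝ, 0 ≤ q ∧ ∀ t : ℝ, ineqFun (approxConstraint z.B) i (z + t • d)
        = ineqFun worstConstraint i z + t * L d - t ^ 2 * q := by
  let epsL : Vars K N →L[ℝ] ℝ := ContinuousLinearMap.fst ℝ _ _ ∘L
    ContinuousLinearMap.snd ℝ _ _ ∘L ContinuousLinearMap.snd ℝ _ _
  have heps : ∀ (d : Vars K N) (t : ℝ), (z + t • d).eps = z.eps + t * epsL d := fun _ _ => rfl
  rcases i with _ | _ | ⟨k, n⟩ | x | x
  · refine ⟨epsL, epsL.hasFDerivAt, fun d => ⟨0, le_rfl, fun t => ?_⟩⟩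
    simp only [ineqFun, heps]
    ring
  · refine ⟨-epsL, epsL.hasFDerivAt.const_sub 1, fun d => ⟨0, le_rfl, fun t => ?_⟩⟩
    simp only [ineqFun, heps, neg_apply]
    ring
  · let L : Vars K N →L[ℝ] ℝ := (ContinuousLinearMap.proj n : (Fin N → ℝ) →L[ℝ] ℝ) ∘L
      (ContinuousLinearMap.proj k : (Fin K → Fin N → ℝ) →L[ℝ] (Fin N → ℝ)) ∘L
      ContinuousLinearMap.fst ℝ _ _
    have hL : ∀ (d : Vars K N) (t : ℝ), (z + t • d).B k n = z.B k n + t * L d := fun _ _ => rfl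
    refine ⟨L, L.hasFDerivAt, fun d => ⟨0, le_rfl, fun t => ?_⟩⟩
    simp only [ineqFun, hL]
    ring
  · let L : Vars K N →L[ℝ] ℝ := ContinuousLinearMap.proj x ∘L
      ContinuousLinearMap.fst ℝ _ _ ∘L ContinuousLinearMap.snd ℝ _ _
    have hL : ∀ (d : Vars K N) (t : ℝ), (z + t • d).lam x = z.lam x + t * L d := fun _ _ => rfl
    refine ⟨L, L.hasFDerivAt, fun d => ⟨0, le_rfl, fun t => ?_⟩⟩
    simp only [ineqFun, hL]
    ring
  · obtain ⟨L, hL, -, hexp⟩ := worstConstraint_expansion x z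
    refine ⟨L, hL, fun d => ⟨_, ?_, fun t => hexp d t⟩⟩
    exact mul_nonneg (by positivity) (Finset.sum_nonneg fun k _ =>
      mul_nonneg (act_nonneg x k) (Finset.sum_nonneg fun n _ => sq_nonneg _))

lemma eqFun_expansion (z : Vars K N) (k : Fin K) :
    ∃ L : Vars K N →L[ℝ] ℝ, HasFDerivAt (eqFun k) L z ∧
      ∀ (d : Vars K N) (t : ℝ), eqFun k (z + t • d) = eqFun k z + t * L d := by
  let epsL : Vars K N →L[ℝ] ℝ := ContinuousLinearMap.fst ℝ _ _ ∘L
    ContinuousLinearMap.snd ℝ _ _ ∘L ContinuousLinearMap.snd ℝ _ _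
  let bL : Fin N → Vars K N →L[ℝ] ℝ := fun n =>
    (ContinuousLinearMap.proj n : (Fin N → ℝ) →L[ℝ] ℝ) ∘L
      (ContinuousLinearMap.proj k : (Fin K → Fin N → ℝ) →L[ℝ] (Fin N → ℝ)) ∘L
      ContinuousLinearMap.fst ℝ _ _
  have hL : ∀ w : Vars K N, eqFun k w = (∑ n, bL n - epsL) w := fun w => by
    simp only [sub_apply, sum_apply]
    rfl
  refine ⟨∑ n, bL n - epsL, ((∑ n, bL n - epsL).hasFDerivAt).congr_of_eventuallyEq
    (Eventually.of_forall hL), fun d t => ?_⟩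
  rw [hL, hL, map_add, map_smul, smul_eq_mul]

lemma mem_unit_of_feasible {c : ActivityState K → Vars K N → ℝ} {z : Vars K N}
    (hi : ∀ i, 0 ≤ ineqFun c i z) (he : ∀ k, eqFun k z = 0) (k : Fin K) (n : Fin N) :
    0 ≤ z.B k n ∧ z.B k n ≤ 1 := by
  have hB : ∀ n, 0 ≤ z.B k n := fun n => hi (.inr (.inr (.inl (k, n))))
  have h1 : 0 ≤ 1 - z.eps := hi (.inr (.inl ()))
  have h2 : ∑ n, z.B k n - z.eps = 0 := he k
  have h3 := Finset.single_le_sum (fun n _ => hB n) (Finset.mem_univ n)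
  exact ⟨hB n, by linarith⟩

lemma initialPoint_feasible (pHat δ : ActivityState K → ℝ) (n : Fin K → Fin N) :
    initialPoint n ∈ (worstProblem pHat δ).feasible := by
  have hB : ∀ k m, 0 ≤ (initialPoint n).B k m ∧ (initialPoint n).B k m ≤ 1 := fun k m => by
    by_cases h : m = n k <;> simp [initialPoint, Vars.B, h]
  refine ⟨?_, fun k => ?_⟩
  · rintro (_ | _ | ⟨k, m⟩ | x | x)
    · simp [worstProblem, ineqFun, initialPoint, Vars.eps]
    · simp [worstProblem, ineqFun, initialPoint, Vars.eps]
    · exact (hB k m).1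
    · simp [worstProblem, ineqFun, initialPoint, Vars.lam]
    · have := throughput_nonneg hB x
      simp only [worstProblem, ineqFun, worstConstraint]
      have h1 : (initialPoint n).nu = 0 := rfl
      have h2 : (initialPoint n).lam x = 1 := rfl
      linarith
  · simp [worstProblem, eqFun, initialPoint, Vars.B, Vars.eps]

/-- Slater's condition holds for every approximate problem, as `λ` is not bounded above. -/
lemma exists_strictly_feasible (n : Fin K → Fin N) (B' : Fin K → Fin N → ℝ) :
    ∃ w : Vars K N, (∀ k, eqFun k w = 0) ∧ ∀ i, 0 < ineqFun (approxConstraint B') i w := by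
  -- Equal entries `1 / (2N)` sum to `ε = 1/2`, strictly inside `[0, 1]`; raising `λ` from 0 by more
  -- than the possible deficit at `w₀` makes the throughput constraints strict.
  let w₀ : Vars K N := (fun _ _ => 1 / (2 * (N : ℝ)), 0, 1 / 2, 0)
  let w : Vars K N := (fun _ _ => 1 / (2 * (N : ℝ)),
    fun x => 1 + |approxConstraint B' x w₀|, 1 / 2, 0)
  have hN : ∀ m : Fin N, (0 : ℝ) < N := fun m => by exact_mod_cast Fin.pos m
  refine ⟨w, fun k => ?_, ?_⟩
  · have := (hN (n k)).ne'
    simp only [eqFun, Vars.B, Vars.eps, w, Finset.sum_const, Finset.card_univ, Fintype.card_fin,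
      nsmul_eq_mul]
    field_simp
    ring
  · rintro (_ | _ | ⟨k, m⟩ | x | x)
    · simp [ineqFun, Vars.eps, w]
    · norm_num [ineqFun, Vars.eps, w]
    · have := hN m
      simp only [ineqFun, Vars.B, w]
      positivity
    · simp only [ineqFun, Vars.lam, w]
      positivity
    · have h : approxConstraint B' x w
          = approxConstraint B' x w₀ + (1 + |approxConstraint B' x w₀|) := by
        simp only [approxConstraint, Vars.B, Vars.lam, Vars.nu, w, w₀, Pi.zero_apply]
        ring
      simp only [ineqFun, h]
      linarith [neg_abs_le (approxConstraint B' x w₀)]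

/-- The current point is feasible for its own approximate problem with the exact objective value, so
the optimum predicts a nonnegative gain. Concavity retains the fraction `γ` of it, and the minorant
property carries feasibility and gain over to the exact problem. -/
lemma sca_step {pHat δ : ActivityState K → ℝ} {γ : ℝ} (hγ : 0 < γ ∧ γ ≤ 1) {z zHat : Vars K N}
    (hz : z ∈ (worstProblem pHat δ).feasible)
    (hopt : (approxProblem pHat δ z.B).IsOptimal zHat) :
    (1 - γ) • z + γ • zHat ∈ (worstProblem pHat δ).feasible ∧
      worstObjective pHat δ z ≤ approxObjective pHat δ z.B zHat ∧
      worstObjective pHat δ z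
        + γ * (approxObjective pHat δ z.B zHat - worstObjective pHat δ z)
        ≤ worstObjective pHat δ ((1 - γ) • z + γ • zHat) := by
  obtain ⟨hzi, hze⟩ := hz
  obtain ⟨⟨hHi, hHe⟩, hmax⟩ := hopt
  -- For `a + t * b - t ^ 2 * q`, the excess at `t = γ` over linear interpolation between `t = 0`
  -- and `t = 1` is `(γ - γ ^ 2) * q`.
  have hγ2 : 0 ≤ γ - γ ^ 2 := by nlinarith [hγ.1, hγ.2]
  set d := zHat - z with hd
  have hnew : (1 - γ) • z + γ • zHat = z + γ • d := by rw [hd]; module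
  have hHat : zHat = z + (1 : ℝ) • d := by rw [hd]; module
  have hself : z = z + (0 : ℝ) • d := by module
  have hzapprox : z ∈ (approxProblem pHat δ z.B).feasible := by
    refine ⟨fun i => ?_, hze⟩
    obtain ⟨L, -, hL⟩ := ineqFun_expansion z i
    obtain ⟨q, -, hq⟩ := hL d
    have h0 := hq 0
    rw [← hself] at h0
    have := hzi i
    simp only [worstProblem, approxProblem] at this ⊢
    linarith
  rw [hnew]
  have hi : ∀ i, 0 ≤ ineqFun (approxConstraint z.B) i (z + γ • d) := fun i => by
    obtain ⟨L, -, hL⟩ := ineqFun_expansion z i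
    obtain ⟨q, hq0, hq⟩ := hL d
    have h1 : 0 ≤ ineqFun (approxConstraint z.B) i zHat := hHi i
    have h2 : 0 ≤ ineqFun worstConstraint i z := hzi i
    rw [hHat, hq] at h1
    rw [hq]
    nlinarith [mul_nonneg hγ2 hq0, mul_nonneg hγ.1.le h1, mul_nonneg (sub_nonneg.2 hγ.2) h2]
  have he : ∀ k, eqFun k (z + γ • d) = 0 := fun k => by
    obtain ⟨L, -, hL⟩ := eqFun_expansion z k
    have h1 : eqFun k zHat = 0 := hHe k
    have h2 : eqFun k z = 0 := hze k
    rw [hHat, hL] at h1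
    rw [hL]
    linear_combination γ * h1 + (1 - γ) * h2
  have hboxz := mem_unit_of_feasible hzi hze
  have hbox := mem_unit_of_feasible hi he
  obtain ⟨L, -, hL⟩ := worstObjective_expansion pHat δ z
  have hobj1 := hL d 1
  have hobjγ := hL d γ
  have hobj0 := hL d 0
  rw [← hHat] at hobj1
  rw [← hself] at hobj0
  have hle := approxObjective_le_worstObjective pHat δ hboxz hbox
  have hmax' : approxObjective pHat δ z.B z ≤ approxObjective pHat δ z.B zHat := hmax hzapprox
  have hQ : 0 ≤ 1 / 2 * curvature N pHat δ * ∑ k, ∑ n, d.B k n ^ 2 := by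
    have : 0 ≤ curvature N pHat δ := Real.sqrt_nonneg _
    positivity
  refine ⟨⟨?_, he⟩, by linarith, by nlinarith [mul_nonneg hγ2 hQ]⟩
  rintro (_ | _ | ⟨k, m⟩ | x | x)
  · exact hi (.inl ())
  · exact hi (.inr (.inl ()))
  · exact hi (.inr (.inr (.inl (k, m))))
  · exact hi (.inr (.inr (.inr (.inl x))))
  · exact (hi (.inr (.inr (.inr (.inr x))))).trans
      (approxConstraint_le_worstConstraint hboxz hbox x)

lemma eventually_quadratic_pos {a b q : ℝ} (ha : 0 ≤ a) (hb : a = 0 → 0 < b) :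
    ∀ᶠ t in 𝓝[>] (0 : ℝ), 0 < a + t * b - t ^ 2 * q := by
  rcases ha.eq_or_lt with h | h
  · have hb := hb h.symm
    have hc : Tendsto (fun t : ℝ => b - t * q) (𝓝[>] 0) (𝓝 (b - 0 * q)) :=
      (Continuous.tendsto (by fun_prop) 0).mono_left nhdsWithin_le_nhds
    filter_upwards [hc.eventually_const_lt (by simpa using hb), self_mem_nhdsWithin] with t ht ht0
    have := mul_pos (Set.mem_Ioi.1 ht0) ht
    rw [← h]
    linarith
  · have hc : Tendsto (fun t : ℝ => a + t * b - t ^ 2 * q) (𝓝[>] 0)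
        (𝓝 (a + 0 * b - 0 ^ 2 * q)) :=
      (Continuous.tendsto (by fun_prop) 0).mono_left nhdsWithin_le_nhds
    exact hc.eventually_const_lt (by simpa using h)

lemma continuous_throughput (x : ActivityState K) :
    Continuous fun z : Vars K N => throughput z.B 1 x := by
  unfold throughput Vars.B
  fun_prop

lemma continuous_gCoef (k : Fin K) (n : Fin N) (x : ActivityState K) :
    Continuous fun z : Vars K N => gCoef k n z.B 1 x := by
  unfold gCoef Vars.B
  fun_prop

lemma continuous_B_apply (k : Fin K) (n : Fin N) : Continuous fun z : Vars K N => z.B k n := by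
  unfold Vars.B
  fun_prop

lemma continuous_approxConstraint_base (x : ActivityState K) (w : Vars K N) :
    Continuous fun z : Vars K N => approxConstraint z.B x w := by
  have h1 := continuous_throughput (N := N) x
  have h2 := fun k n => continuous_gCoef (N := N) k n x
  have h3 := continuous_B_apply (K := K) (N := N)
  unfold approxConstraint
  fun_prop

lemma continuous_approxObjective_base (pHat δ : ActivityState K → ℝ) (w : Vars K N) :
    Continuous fun z : Vars K N => approxObjective pHat δ z.B w := by
  have h1 := continuous_throughput (K := K) (N := N)
  have h2 := continuous_gCoef (K := K) (N := N)
  have h3 := continuous_B_apply (K := K) (N := N)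
  unfold approxObjective
  fun_prop

lemma continuous_worstObjective (pHat δ : ActivityState K → ℝ) :
    Continuous (worstObjective (N := N) pHat δ) :=
  continuous_iff_continuousAt.2 fun z =>
    (worstObjective_expansion pHat δ z).choose_spec.1.continuousAt

lemma isClosed_worstFeasible (pHat δ : ActivityState K → ℝ) :
    IsClosed (worstProblem (N := N) pHat δ).feasible := by
  have hi : ∀ i, Continuous (ineqFun (K := K) (N := N) worstConstraint i) := fun i =>
    continuous_iff_continuousAt.2 fun z => (ineqFun_expansion z i).choose_spec.1.continuousAt
  have he : ∀ k, Continuous (eqFun (N := N) k : Vars K N → ℝ) := fun k =>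
    continuous_iff_continuousAt.2 fun z => (eqFun_expansion z k).choose_spec.1.continuousAt
  have : (worstProblem (N := N) pHat δ).feasible
      = (⋂ i, {z | 0 ≤ ineqFun worstConstraint i z}) ∩ ⋂ k, {z | eqFun k z = 0} := by
    ext z
    simp only [Set.mem_inter_iff, Set.mem_iInter, Set.mem_ofPred_eq]
    rfl
  rw [this]
  exact (isClosed_iInter fun i => isClosed_le continuous_const (hi i)).inter
    (isClosed_iInter fun k => isClosed_eq (he k) continuous_const)

/-- A strictly feasible point of the approximate problem at a limit point of the iterates does not
improve on the objective value of the limit point. -/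
lemma approxObjective_le_of_limit {pHat δ : ActivityState K → ℝ} {γ : ℝ} (hγ : 0 < γ ∧ γ ≤ 1)
    {n : Fin K → Fin N} {z : ℕ → Vars K N} (hz : IsSCARun pHat δ γ n z)
    {zLim : Vars K N} (hlim : MapClusterPt zLim atTop z) {w : Vars K N}
    (hwe : ∀ k, eqFun k w = 0) (hwi : ∀ i, 0 < ineqFun (approxConstraint zLim.B) i w) :
    zLim ∈ (worstProblem pHat δ).feasible ∧
      approxObjective pHat δ zLim.B w ≤ worstObjective pHat δ zLim := by
  obtain ⟨hz0, hzs⟩ := hz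
  choose zHat hopt hstep using hzs
  have hfeas : ∀ s, z s ∈ (worstProblem pHat δ).feasible := fun s => by
    induction s with
    | zero => rw [hz0]; exact initialPoint_feasible pHat δ n
    | succ s ih => rw [hstep]; exact (sca_step hγ ih (hopt s)).1
  refine ⟨(isClosed_worstFeasible pHat δ).mem_of_mapClusterPt hlim
    (Eventually.of_forall hfeas), ?_⟩
  have hinc : ∀ s, worstObjective pHat δ (z s)
      + γ * (approxObjective pHat δ (z s).B (zHat s) - worstObjective pHat δ (z s))
      ≤ worstObjective pHat δ (z (s + 1)) := fun s => by
    rw [hstep]; exact (sca_step hγ (hfeas s) (hopt s)).2.2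
  have hmono : Monotone fun s => worstObjective pHat δ (z s) := monotone_nat_of_le_succ fun s => by
    have h1 := (sca_step hγ (hfeas s) (hopt s)).2.1
    have h2 := mul_nonneg hγ.1.le (sub_nonneg.2 h1)
    linarith [hinc s]
  have hcont := continuous_worstObjective (N := N) pHat δ
  -- An increasing sequence that once exceeded the limit value would stay above it and could not
  -- return near it.
  have hle : ∀ s, worstObjective pHat δ (z s) ≤ worstObjective pHat δ zLim := fun s => by
    by_contra! hlt
    obtain ⟨s', hs', h⟩ := (hlim.frequently
      (hcont.continuousAt.eventually_lt_const hlt)).forall_exists_of_atTop s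
    exact absurd (hmono hs') (not_le.2 h)
  by_contra! hlt
  -- Near `zLim` the gain that `w` guarantees in one step exceeds the distance remaining to the
  -- limit value.
  have hev1 : ∀ᶠ y in 𝓝 zLim, 0 < γ * (approxObjective pHat δ y.B w - worstObjective pHat δ y)
      - (worstObjective pHat δ zLim - worstObjective pHat δ y) := by
    have hc : Continuous fun y : Vars K N =>
        γ * (approxObjective pHat δ y.B w - worstObjective pHat δ y)
          - (worstObjective pHat δ zLim - worstObjective pHat δ y) :=
      ((continuous_const.mul ((continuous_approxObjective_base pHat δ w).sub hcont))).sub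
        (continuous_const.sub hcont)
    refine hc.continuousAt.eventually_const_lt ?_
    have := mul_pos hγ.1 (sub_pos.2 hlt)
    linarith
  -- Only the throughput constraints depend on the base point; being strict at `zLim`, they survive
  -- a small change of it.
  have hev2 : ∀ᶠ y in 𝓝 zLim, ∀ x, 0 < approxConstraint y.B x w :=
    eventually_all.2 fun x => (continuous_approxConstraint_base x w).continuousAt.eventually_const_lt
      (hwi (.inr (.inr (.inr (.inr x)))))
  obtain ⟨s, hs1, hs2⟩ := (hlim.frequently (hev1.and hev2)).exists
  have hw : w ∈ (approxProblem pHat δ (z s).B).feasible := by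
    refine ⟨?_, hwe⟩
    rintro (_ | _ | ⟨k, m⟩ | x | x)
    · exact (hwi (.inl ())).le
    · exact (hwi (.inr (.inl ()))).le
    · exact (hwi (.inr (.inr (.inl (k, m))))).le
    · exact (hwi (.inr (.inr (.inr (.inl x))))).le
    · exact (hs2 x).le
  have h1 : approxObjective pHat δ (z s).B w ≤ approxObjective pHat δ (z s).B (zHat s) :=
    (hopt s).2 hw
  have h2 := hinc s
  have h3 := hle (s + 1)
  have h4 := mul_le_mul_of_nonneg_left (sub_le_sub_right h1 (worstObjective pHat δ (z s))) hγ.1.le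
  linarith

end convergence

theorem theorem6 {K N : ℕ} (p pHat δ : ActivityState K → ℝ)
    (hp_nonneg : ∀ x, 0 ≤ p x) (hp_sum : ∑ x, p x = 1) (hp_zero : p (fun _ => false) < 1)
    (hδ : ∀ x, 0 ≤ δ x ∧ δ x < 1)
    (herr_sum : ∑ x, (p x - pHat x) = 0) (herr : ∀ x, |p x - pHat x| ≤ δ x)
    (γ : ℝ) (hγ : 0 < γ ∧ γ ≤ 1)
    (n : Fin K → Fin N) (z : ℕ → Vars K N) (hz : IsSCARun pHat δ γ n z)
    (zLim : Vars K N) (hlim : MapClusterPt zLim atTop z)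
    (hslater : (interior ((↑) ⁻¹' approxConstraintSet zLim.B :
      Set (equalitySubspace K N))).Nonempty) :
    (worstProblem (N := N) pHat δ).IsKKTPoint zLim := by
  obtain ⟨w, hwe, hwi⟩ := exists_strictly_feasible n zLim.B
  have hfeas := (approxObjective_le_of_limit hγ hz hlim hwe hwi).1
  obtain ⟨f, hf, hfexp⟩ := worstObjective_expansion pHat δ zLim
  choose g hg hgexp using ineqFun_expansion zLim
  choose h hh hhexp using eqFun_expansion zLim
  have hfeas_i : ∀ i, 0 ≤ ineqFun worstConstraint i zLim := hfeas.1
  have hfeas_e : ∀ k, eqFun k zLim = 0 := hfeas.2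
  -- A short move along an ascent direction would give a strictly feasible point of the approximate
  -- problem at `zLim` with a larger approximate objective.
  have hno : ∀ d, (∀ k, h k d = 0) → (∀ i, ineqFun worstConstraint i zLim = 0 → 0 < g i d) →
      f d ≤ 0 := by
    intro d hde hdi
    by_contra! hfd
    have hev : ∀ᶠ t in 𝓝[>] (0 : ℝ),
        (∀ i, 0 < ineqFun (approxConstraint zLim.B) i (zLim + t • d)) ∧
          worstObjective pHat δ zLim < approxObjective pHat δ zLim.B (zLim + t • d) := by
      refine (eventually_all.2 fun i => ?_).and ?_
      · obtain ⟨q, -, hq⟩ := hgexp i d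
        filter_upwards [eventually_quadratic_pos (q := q) (hfeas_i i) (hdi i)] with t ht
        rwa [hq]
      · filter_upwards [eventually_quadratic_pos
          (q := 1 / 2 * curvature N pHat δ * ∑ k, ∑ n, d.B k n ^ 2) le_rfl fun _ => hfd] with t ht
        rw [hfexp]
        linarith
    obtain ⟨t, hti, hto⟩ := hev.exists
    exact absurd (approxObjective_le_of_limit hγ hz hlim
      (fun k => by rw [hhexp, hfeas_e, hde, mul_zero, add_zero]) hti).2 (not_le.2 hto)
  -- Slater's condition gives a Mangasarian-Fromovitz direction: at an active constraint, the
  -- expansion at `w` reads `0 < g i d - q` with `q ≥ 0`.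
  have hmf : ∃ d, (∀ k, h k d = 0) ∧
      ∀ i, ineqFun worstConstraint i zLim = 0 → 0 < g i d := by
    have hw : w = zLim + (1 : ℝ) • (w - zLim) := by module
    refine ⟨w - zLim, fun k => ?_, fun i hi => ?_⟩
    · have h1 := hwe k
      rw [hw, hhexp, hfeas_e] at h1
      linarith
    · obtain ⟨q, hq0, hq⟩ := hgexp i (w - zLim)
      have h1 := hwi i
      rw [hw, hq, hi] at h1
      linarith
  obtain ⟨μ, η, hμ, hcomp, hstat⟩ := exists_multipliers_of_no_ascent f g h
    (fun i => ineqFun worstConstraint i zLim = 0) hno hmf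
  refine ⟨hf.differentiableAt, fun i => (hg i).differentiableAt,
    fun k => (hh k).differentiableAt, hfeas, μ, η, hμ, fun i => ?_, ?_⟩
  · by_cases hi : ineqFun worstConstraint i zLim = 0
    · exact mul_eq_zero_of_right _ hi
    · rw [hcomp i hi, zero_mul]
  · change fderiv ℝ (worstObjective pHat δ) zLim
      + ∑ i, μ i • fderiv ℝ (ineqFun worstConstraint i) zLim
      + ∑ k, η k • fderiv ℝ (eqFun k) zLim = 0
    rw [hf.fderiv, ← hstat]
    simp only [fun i => (hg i).fderiv, fun k => (hh k).fderiv]
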